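/- **Setting (the logic $\mathcal G$).** Terms are those of Church's simply typed $\lambda$-calculus over base types and the type $o$ of propositions, identified up to $\alpha\beta\eta$-conversion; formulas are the terms of type $o$. Constants are partitioned into nominal constants $\mathcal C$ (infinitely many at each type at which $\nabla$-quantification is permitted, or at which there is a nominal constant at all; these types do not contain $o$) and non-nominal constants $\mathcal K$, which include the logical constants $\top,\bot,\wedge,\vee,\supset,\forall_\tau,\exists_\tau,\nabla_\tau$ and nominal abstraction $\unrhd$; $o$ does not occur in the argument types of nonlogical constants. The support of a term is the set of nominal constants in its normal form. A permutation of nominal constants is a type-preserving bijection $\pi:\mathcal C\to\mathcal C$ that moves only finitely many constants, $\pi.t$ is its action on terms, and $B\approx B'$ means that $B$ is $\lambda$-convertible to $\pi.B'$ for some such $\pi$. The formula $s\unrhd t$ *holds* if $s$ $\lambda$-converts to $\lambda c_1\cdots\lambda c_n.t$ for some distinct nominal constants $c_1,\dots,c_n$. For a finite substitution $\theta$, $B[\![\theta]\!]$ is $(\pi.B)[\theta]$ for any permutation $\pi$ that moves the support of $B$ off the support of $\theta$; $\theta$ is a solution of $s\unrhd t$ if $(s\unrhd t)[\![\theta]\!]$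 holds. Fix a definition: a finite set of plain, inductive ($\mu$) or co-inductive ($\nu$) clauses $\forall\vec x.\,p\,\vec x\triangleq B\,p\,\vec x$, at most one for each predicate constant $p$, in which $B$ is a closed term that contains neither $p$ nor any nominal constant. (No stratification of the clauses is needed here.) A sequent $\Sigma:\Gamma\vdash C$ consists of a finite set $\Sigma$ of variables whose types do not contain $o$, a multiset $\Gamma$ of formulas and a formula $C$, all of whose free variables are in $\Sigma$. The proof rules are: * $id$: $\Sigma:\Gamma,B\vdash B'$ if $B\approx B'$; $cut$ (from $\Sigma:\Gamma\vdash B$ and $\Sigma:B,\Delta\vdash C$ infer $\Sigma:\Gamma,\Delta\vdash C$); contraction on the left; the usual intuitionistic left and right rules for $\bot,\top,\wedge,\vee,\supset$; * $\forall\mathcal L,\exists\mathcal R$, with any instance $B[t/x]$ where $t$ has its free variables in $\Sigma$; $\forall\mathcal R,\exists\mathcal L$, with premise instance $B[h\,\vec c/x]$, where $h\notin\Sigma$ is added to $\Sigma$ and $\vec c$ lists the support of $B$ without repetition; $\nabla\mathcal L,\nabla\mathcal R$, with premise instance $B[a/x]$, where $a$ is a nominal constant not in the support of $B$; * $\unrhd\mathcal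 R$: $\Sigma:\Gamma\vdash s\unrhd t$ if $s\unrhd t$ holds; $\unrhd\mathcal L$: from the premises $\Sigma\theta:\Gamma[\![\theta]\!]\vdash C[\![\theta]\!]$, one for each solution $\theta$ of $s\unrhd t$, infer $\Sigma:\Gamma,s\unrhd t\vdash C$; here $\Sigma\theta$ is $\Sigma$ without the domain of $\theta$, together with the free variables of the range of $\theta$; * $def\mathcal L,def\mathcal R$: replace $p\,\vec t$ in the conclusion by $B\,p\,\vec t$ in the premise, if $p$ is defined by $B$; * $\mathcal{IL}$ (for $\mu$-clauses): from $\vec x:B\,S\,\vec x\vdash S\,\vec x$ and $\Sigma:\Gamma,S\,\vec t\vdash C$ infer $\Sigma:\Gamma,p\,\vec t\vdash C$; $\mathcal{CIR}$ (for $\nu$-clauses): from $\Sigma:\Gamma\vdash S\,\vec t$ and $\vec x:S\,\vec x\vdash B\,S\,\vec x$ infer $\Sigma:\Gamma\vdash p\,\vec t$; here $S$ is a closed term without nominal constants and $\vec x$ are distinct variables. The height $\mathrm{ht}(\Pi)$ of a proof is $1$ if it has no premise proofs, and otherwise the least upper bound of the ordinals $\mathrm{ht}(\Pi_i)+1$ over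 its premise proofs $\Pi_i$. Two proofs have *the same structure* if they are isomorphic as trees, the same rules occur at corresponding places, and the corresponding sequents, and the formulas on which the rules operate, are obtained from each other by a renaming of eigenvariables and by permuting nominal constants separately in each formula. **Lemma.** Let $\Pi$ be a proof of $\Sigma:B_1,\dots,B_n\vdash B_0$ and let $B_i\approx B_i'$ for $i\in\{0,1,\dots,n\}$. Then there is a proof $\Pi'$ of $\Sigma:B_1',\dots,B_n'\vdash B_0'$ that has the same structure as $\Pi$. In particular, $\mathrm{ht}(\Pi)=\mathrm{ht}(\Pi')$, and $\Pi$ and $\Pi'$ end with the same rule application. -/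

import Mathlib

set_option linter.unusedVariables false

universe u

namespace LogicG

/-! ## Types and the vocabulary -/

/-- Simple types over a collection of base types, with `o` the type of propositions. -/
inductive Ty (Base : Type u) : Type u
  | o : Ty Base
  | base (b : Base) : Ty Base
  | arr (a b : Ty Base) : Ty Base

namespace Ty

variable {Base : Type u}

/-- The type `o` does not appear in the type. -/
def OFree : Ty Base → Prop
  | o => False
  | base _ => True
  | arr a b => a.OFree ∧ b.OFree

/-- The type `o` does not appear in the argument types of the type. -/
def ArgsOFree : Ty Base → Prop
  | o => True
  | base _ => True
  | arr a b => a.OFree ∧ b.ArgsOFree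

/-- `arrows [τ₁, …, τₙ] τ` is `τ₁ → ⋯ → τₙ → τ`. -/
def arrows : List (Ty Base) → Ty Base → Ty Base
  | [], τ => τ
  | a :: as, τ => arr a (arrows as τ)

end Ty

/-- The parameters of the logic: base types, the types at which `∇` is permitted, the nonlogical
non-nominal constants and the nominal constants of each type. A type that has a nominal constant
at all has infinitely many, so that nominal capture avoiding substitution is always possible. -/
structure Lang where
  Base : Type u
  NablaOK : Ty Base → Prop
  nabla_oFree : ∀ τ, NablaOK τ → τ.OFree
  Con : Ty Base → Type u
  con_argsOFree : ∀ τ, Con τ → τ.ArgsOFree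
  Nom : Ty Base → Type u
  nom_oFree : ∀ τ, Nom τ → τ.OFree
  nom_infinite : ∀ τ, NablaOK τ ∨ Nonempty (Nom τ) → Infinite (Nom τ)

variable {L : Lang.{u}}

/-- Eigenvariables (the free variables of terms) of type `τ`: countably many for each type in
which `o` does not appear, and none for the other types. -/
structure EVar (L : Lang.{u}) (τ : Ty L.Base) : Type u where
  name : ℕ
  oFree : τ.OFree

/-- The logical constants, including nominal abstraction `⊵` of every degree. -/
inductive Logical (L : Lang.{u}) : Ty L.Base → Type u
  | top : Logical L .o
  | bot : Logical L .o
  | and : Logical L (.arr .o (.arr .o .o))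
  | or : Logical L (.arr .o (.arr .o .o))
  | imp : Logical L (.arr .o (.arr .o .o))
  | all (τ : Ty L.Base) (h : τ.OFree) : Logical L (.arr (.arr τ .o) .o)
  | ex (τ : Ty L.Base) (h : τ.OFree) : Logical L (.arr (.arr τ .o) .o)
  | nabla (τ : Ty L.Base) (h : L.NablaOK τ) : Logical L (.arr (.arr τ .o) .o)
  | nabs (τs : List (Ty L.Base)) (τ : Ty L.Base) :
      Logical L (.arr (Ty.arrows τs τ) (.arr τ .o))

/-- Atomic terms other than bound variables. -/
inductive Atom (L : Lang.{u}) (τ : Ty L.Base) : Type u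
  | var (x : EVar L τ) : Atom L τ
  | nom (c : L.Nom τ) : Atom L τ
  | con (k : L.Con τ) : Atom L τ
  | logic (l : Logical L τ) : Atom L τ

/-! ## Terms -/

/-- de Bruijn indices for bound variables. -/
inductive Mem {Base : Type u} : List (Ty Base) → Ty Base → Type u
  | here {Γ : List (Ty Base)} {τ : Ty Base} : Mem (τ :: Γ) τ
  | there {Γ : List (Ty Base)} {σ τ : Ty Base} (m : Mem Γ τ) : Mem (σ :: Γ) τ

/-- Simply typed terms; the list contains the types of the bound variables in scope. -/
inductive Term (L : Lang.{u}) : List (Ty L.Base) → Ty L.Base → Type u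
  | bvar {Γ : List (Ty L.Base)} {τ : Ty L.Base} (m : Mem Γ τ) : Term L Γ τ
  | atom {Γ : List (Ty L.Base)} {τ : Ty L.Base} (a : Atom L τ) : Term L Γ τ
  | app {Γ : List (Ty L.Base)} {σ τ : Ty L.Base}
      (s : Term L Γ (.arr σ τ)) (t : Term L Γ σ) : Term L Γ τ
  | lam {Γ : List (Ty L.Base)} {σ τ : Ty L.Base}
      (t : Term L (σ :: Γ) τ) : Term L Γ (.arr σ τ)

namespace Term

variable {Γ Δ Θ : List (Ty L.Base)} {σ τ : Ty L.Base}

/-- Extension of a renaming of indices below a binder. -/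
def liftRen (ρ : ∀ τ, Mem Γ τ → Mem Δ τ) : ∀ τ, Mem (σ :: Γ) τ → Mem (σ :: Δ) τ
  | _, .here => .here
  | _, .there m => .there (ρ _ m)

/-- Renaming of indices. -/
def rename {Γ : List (Ty L.Base)} {τ : Ty L.Base} (t : Term L Γ τ) :
    ∀ {Δ : List (Ty L.Base)}, (∀ τ, Mem Γ τ → Mem Δ τ) → Term L Δ τ :=
  match t with
  | bvar m => fun ρ => bvar (ρ _ m)
  | atom a => fun _ => atom a
  | app s t => fun ρ => app (s.rename ρ) (t.rename ρ)
  | lam t => fun ρ => lam (t.rename (liftRen ρ))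

/-- Weakening by one bound variable. -/
def wk (t : Term L Γ τ) : Term L (σ :: Γ) τ :=
  t.rename fun _ m => .there m

/-- Extension of a replacement of indices by terms below a binder. -/
def liftSub (b : ∀ τ, Mem Γ τ → Term L Δ τ) : ∀ τ, Mem (σ :: Γ) τ → Term L (σ :: Δ) τ
  | _, .here => bvar .here
  | _, .there m => wk (b _ m)

/-- Simultaneous capture-avoiding replacement of the bound variables in scope and of the atoms
of a term. All the operations on terms that are needed are instances of this one. -/
def bind {Γ : List (Ty L.Base)} {τ : Ty L.Base} (t : Term L Γ τ) :
    ∀ {Δ : List (Ty L.Base)}, (∀ τ, Mem Γ τ → Term L Δ τ) → (∀ τ, Atom L τ → Term L Δ τ) →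
      Term L Δ τ :=
  match t with
  | bvar m => fun b _ => b _ m
  | atom a => fun _ f => f _ a
  | app s t => fun b f => app (s.bind b f) (t.bind b f)
  | lam t => fun b f => lam (t.bind (liftSub b) fun _ a => wk (f _ a))

/-- The replacement of the innermost bound variable by `a`. -/
def consSub (a : Term L Γ σ) : ∀ τ, Mem (σ :: Γ) τ → Term L Γ τ
  | _, .here => a
  | _, .there m => bvar m

/-- The body `t` of an abstraction with its bound variable replaced by `a`. -/
def inst (t : Term L (σ :: Γ) τ) (a : Term L Γ σ) : Term L Γ τ :=
  t.bind (consSub a) fun _ c => atom c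

/-- The set of atoms occurring in a term. -/
def atoms : ∀ {Γ : List (Ty L.Base)} {τ : Ty L.Base}, Term L Γ τ → Set (Σ τ, Atom L τ)
  | _, _, bvar _ => ∅
  | _, τ, atom a => {⟨τ, a⟩}
  | _, _, app s t => s.atoms ∪ t.atoms
  | _, _, lam t => t.atoms

/-- `λ`-convertibility: the congruence generated by `β` and `η` (`α` is built into the
representation of bound variables). -/
inductive Conv : ∀ {Γ : List (Ty L.Base)} {τ : Ty L.Base}, Term L Γ τ → Term L Γ τ → Prop
  | refl {Γ : List (Ty L.Base)} {τ : Ty L.Base} (t : Term L Γ τ) : Conv t t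
  | symm {Γ : List (Ty L.Base)} {τ : Ty L.Base} {s t : Term L Γ τ} : Conv s t → Conv t s
  | trans {Γ : List (Ty L.Base)} {τ : Ty L.Base} {s t r : Term L Γ τ} :
      Conv s t → Conv t r → Conv s r
  | app {Γ : List (Ty L.Base)} {σ τ : Ty L.Base} {s s' : Term L Γ (.arr σ τ)}
      {t t' : Term L Γ σ} : Conv s s' → Conv t t' → Conv (app s t) (app s' t')
  | lam {Γ : List (Ty L.Base)} {σ τ : Ty L.Base} {t t' : Term L (σ :: Γ) τ} :
      Conv t t' → Conv (lam t) (lam t')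
  | beta {Γ : List (Ty L.Base)} {σ τ : Ty L.Base} (t : Term L (σ :: Γ) τ) (a : Term L Γ σ) :
      Conv (Term.app (Term.lam t) a) (t.inst a)
  | eta {Γ : List (Ty L.Base)} {σ τ : Ty L.Base} (t : Term L Γ (.arr σ τ)) :
      Conv (Term.lam (Term.app t.wk (bvar .here))) t

/-! ### Replacement respects convertibility -/

theorem liftRen_comp (ρ : ∀ τ, Mem Γ τ → Mem Δ τ) (ρ' : ∀ τ, Mem Δ τ → Mem Θ τ) :
    (fun τ m => liftRen (σ := σ) ρ' τ (liftRen ρ τ m)) =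
      liftRen (fun τ m => ρ' τ (ρ τ m)) := by
  funext τ m
  cases m <;> rfl

theorem rename_rename {Γ : List (Ty L.Base)} {τ : Ty L.Base} (t : Term L Γ τ) :
    ∀ {Δ Θ : List (Ty L.Base)} (ρ : ∀ τ, Mem Γ τ → Mem Δ τ) (ρ' : ∀ τ, Mem Δ τ → Mem Θ τ),
      (t.rename ρ).rename ρ' = t.rename fun τ m => ρ' τ (ρ τ m) := by
  induction t with
  | bvar m => intros; rfl
  | atom a => intros; rfl
  | app s t ihs iht => intro Δ Θ ρ ρ'; simp only [rename, ihs, iht]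
  | lam t ih => intro Δ Θ ρ ρ'; simp only [rename, ih, liftRen_comp]

theorem bind_rename {Γ : List (Ty L.Base)} {τ : Ty L.Base} (t : Term L Γ τ) :
    ∀ {Δ Θ : List (Ty L.Base)} (ρ : ∀ τ, Mem Γ τ → Mem Δ τ) (b : ∀ τ, Mem Δ τ → Term L Θ τ)
      (f : ∀ τ, Atom L τ → Term L Θ τ),
      (t.rename ρ).bind b f = t.bind (fun τ m => b τ (ρ τ m)) f := by
  induction t with
  | bvar m => intros; rfl
  | atom a => intros; rfl
  | app s t ihs iht => intro Δ Θ ρ b f; simp only [rename, bind, ihs, iht]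
  | lam t ih =>
    intro Δ Θ ρ b f
    simp only [rename, bind, ih]
    congr 2
    funext τ m
    cases m <;> rfl

theorem rename_bind {Γ : List (Ty L.Base)} {τ : Ty L.Base} (t : Term L Γ τ) :
    ∀ {Δ Θ : List (Ty L.Base)} (b : ∀ τ, Mem Γ τ → Term L Δ τ)
      (f : ∀ τ, Atom L τ → Term L Δ τ) (ρ : ∀ τ, Mem Δ τ → Mem Θ τ),
      (t.bind b f).rename ρ =
        t.bind (fun τ m => (b τ m).rename ρ) fun τ a => (f τ a).rename ρ := by
  induction t with
  | bvar m => intros; rfl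
  | atom a => intros; rfl
  | app s t ihs iht => intro Δ Θ b f ρ; simp only [rename, bind, ihs, iht]
  | lam t ih =>
    intro Δ Θ b f ρ
    simp only [rename, bind, ih]
    congr 2
    · funext τ m
      cases m with
      | here => rfl
      | there m => simp only [liftSub, wk, rename_rename, liftRen]
    · funext τ a
      simp only [wk, rename_rename, liftRen]

theorem bind_bind {Γ : List (Ty L.Base)} {τ : Ty L.Base} (t : Term L Γ τ) :
    ∀ {Δ Θ : List (Ty L.Base)} (b : ∀ τ, Mem Γ τ → Term L Δ τ)
      (f : ∀ τ, Atom L τ → Term L Δ τ) (b' : ∀ τ, Mem Δ τ → Term L Θ τ)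
      (f' : ∀ τ, Atom L τ → Term L Θ τ),
      (t.bind b f).bind b' f' =
        t.bind (fun τ m => (b τ m).bind b' f') fun τ a => (f τ a).bind b' f' := by
  induction t with
  | bvar m => intros; rfl
  | atom a => intros; rfl
  | app s t ihs iht => intro Δ Θ b f b' f'; simp only [bind, ihs, iht]
  | lam t ih =>
    intro Δ Θ b f b' f'
    simp only [bind, ih]
    congr 2
    · funext τ m
      cases m with
      | here => rfl
      | there m => simp only [liftSub, wk, bind_rename, rename_bind]
    · funext τ a
      simp only [wk, bind_rename, rename_bind, liftSub]

theorem bind_id {Γ : List (Ty L.Base)} {τ : Ty L.Base} (t : Term L Γ τ) :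
    (t.bind (fun _ m => bvar m) fun _ a => atom a) = t := by
  induction t with
  | bvar m => rfl
  | atom a => rfl
  | app s t ihs iht => simp only [bind, ihs, iht]
  | @lam Γ σ τ t ih =>
    have h : liftSub (σ := σ) (fun τ (m : Mem Γ τ) => (bvar m : Term L Γ τ)) =
        fun _ m => bvar m := by
      funext τ m
      cases m <;> rfl
    simp only [bind, h]
    exact congrArg lam ih

theorem wk_inst (t : Term L Γ τ) (a : Term L Γ σ) : (wk t).inst a = t := by
  simp only [inst, wk, bind_rename, consSub]
  exact bind_id t

theorem wk_bind (t : Term L Γ τ) (b : ∀ τ, Mem Γ τ → Term L Δ τ)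
    (f : ∀ τ, Atom L τ → Term L Δ τ) :
    (wk (σ := σ) t).bind (liftSub b) (fun _ a => wk (f _ a)) = wk (t.bind b f) := by
  simp only [wk, bind_rename, rename_bind, liftSub]

theorem inst_bind (t : Term L (σ :: Γ) τ) (a : Term L Γ σ) (b : ∀ τ, Mem Γ τ → Term L Δ τ)
    (f : ∀ τ, Atom L τ → Term L Δ τ) :
    (t.inst a).bind b f =
      (t.bind (liftSub b) fun _ a => wk (f _ a)).inst (a.bind b f) := by
  simp only [inst, bind_bind]
  congr 1
  · funext τ m
    cases m with
    | here => rfl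
    | there m => exact (wk_inst _ _).symm
  · funext τ c
    exact (wk_inst _ _).symm

theorem Conv.bind {Γ : List (Ty L.Base)} {τ : Ty L.Base} {s t : Term L Γ τ} (h : Conv s t) :
    ∀ {Δ : List (Ty L.Base)} (b : ∀ τ, Mem Γ τ → Term L Δ τ) (f : ∀ τ, Atom L τ → Term L Δ τ),
      Conv (s.bind b f) (t.bind b f) := by
  induction h with
  | refl t => intros; exact .refl _
  | symm _ ih => intro Δ b f; exact (ih b f).symm
  | trans _ _ ih₁ ih₂ => intro Δ b f; exact (ih₁ b f).trans (ih₂ b f)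
  | app _ _ ih₁ ih₂ => intro Δ b f; exact (ih₁ b f).app (ih₂ b f)
  | lam _ ih => intro Δ b f; exact (ih _ _).lam
  | beta t a => intro Δ b f; rw [inst_bind]; exact .beta _ _
  | eta t =>
    intro Δ b f
    simp only [Term.bind, wk_bind, liftSub]
    exact .eta _

/-- Convertibility as a setoid. -/
def convSetoid (L : Lang.{u}) (τ : Ty L.Base) : Setoid (Term L [] τ) where
  r := Conv
  iseqv := ⟨.refl, .symm, .trans⟩

/-- The term in which `c` is replaced by the bound variable. -/
noncomputable def replaceNom (c : L.Nom τ) : ∀ σ, Atom L σ → Term L [τ] σ := fun σ a =>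
  open Classical in
  if h : (⟨σ, a⟩ : Σ σ, Atom L σ) = ⟨τ, .nom c⟩ then
    cast (congrArg (Term L [τ]) (congrArg Sigma.fst h).symm) (bvar .here)
  else atom a

end Term

/-! ## Terms and formulas modulo `λ`-conversion -/

/-- Terms of type `τ` without dangling bound variables, up to `λ`-conversion. -/
def Obj (L : Lang.{u}) (τ : Ty L.Base) : Type u :=
  Quotient (Term.convSetoid L τ)

/-- Formulas are the terms of type `o`. -/
abbrev Formula (L : Lang.{u}) : Type u := Obj L .o

/-- Lists `t₁, …, tₙ` with `tᵢ : F τᵢ`, indexed by `[τ₁, …, τₙ]`. -/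
inductive Args {Base : Type u} (F : Ty Base → Type u) : List (Ty Base) → Type u
  | nil : Args F []
  | cons {τ : Ty Base} {τs : List (Ty Base)} (a : F τ) (as : Args F τs) : Args F (τ :: τs)

namespace Args

variable {Base : Type u} {F G : Ty Base → Type u}

/-- The underlying untyped list. -/
def toList : ∀ {τs : List (Ty Base)}, Args F τs → List (Σ τ, F τ)
  | _, nil => []
  | _, cons a as => ⟨_, a⟩ :: as.toList

/-- Componentwise application of a type preserving function. -/
def map (g : ∀ τ, F τ → G τ) : ∀ {τs : List (Ty Base)}, Args F τs → Args G τs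
  | _, nil => nil
  | _, cons a as => cons (g _ a) (as.map g)

end Args

namespace Obj

variable {σ τ : Ty L.Base}

/-- The class of a term. -/
def mk (t : Term L [] τ) : Obj L τ := Quotient.mk (Term.convSetoid L τ) t

/-- The class of an atom. -/
def atom (a : Atom L τ) : Obj L τ := mk (.atom a)

/-- An eigenvariable as a term. -/
def var (x : EVar L τ) : Obj L τ := atom (.var x)

/-- A nominal constant as a term. -/
def nom (c : L.Nom τ) : Obj L τ := atom (.nom c)

/-- A nonlogical non-nominal constant as a term. -/
def con (k : L.Con τ) : Obj L τ := atom (.con k)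

/-- Application. -/
def app (s : Obj L (.arr σ τ)) (t : Obj L σ) : Obj L τ :=
  Quotient.map₂ Term.app (fun _ _ h _ _ h' => Term.Conv.app h h') s t

/-- The curried application `s t₁ ⋯ tₙ`. -/
def apps : ∀ {τs : List (Ty L.Base)}, Obj L (Ty.arrows τs τ) → Args (Obj L) τs → Obj L τ
  | [], s, .nil => s
  | _ :: _, s, .cons t ts => apps (app s t) ts

/-- Replacement of the atoms of a term. -/
def bindAtoms (f : ∀ τ, Atom L τ → Term L [] τ) (t : Obj L τ) : Obj L τ :=
  Quotient.map (fun t : Term L [] τ => t.bind (fun _ m => .bvar m) f)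
    (fun _ _ h => Term.Conv.bind h _ _) t

/-- The atoms that occur in every term of the class. These are the atoms of the `λ`-normal form,
since `λ`-reduction removes but never creates occurrences of atoms. -/
def atoms (t : Obj L τ) : Set (Σ τ, Atom L τ) :=
  {a | ∀ s : Term L [] τ, mk s = t → a ∈ s.atoms}

/-- The support: the set of nominal constants appearing in the term. -/
def supp (t : Obj L τ) : Set (Σ τ, L.Nom τ) := {c | ⟨c.1, .nom c.2⟩ ∈ t.atoms}

/-- The free variables of the term. -/
def fv (t : Obj L τ) : Set (Σ τ, EVar L τ) := {x | ⟨x.1, .var x.2⟩ ∈ t.atoms}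

/-- `λc.t` for a nominal constant `c`. -/
noncomputable def absNom (c : L.Nom σ) (t : Obj L τ) : Obj L (.arr σ τ) :=
  Quotient.map (fun t : Term L [] τ => Term.lam (t.bind (fun _ m => nomatch m)
      (Term.replaceNom c)))
    (fun _ _ h => (Term.Conv.bind h _ _).lam) t

/-- `λc₁ ⋯ λcₙ.t` for nominal constants `c₁, …, cₙ`. -/
noncomputable def absNoms : ∀ {τs : List (Ty L.Base)}, Args L.Nom τs → Obj L τ →
    Obj L (Ty.arrows τs τ)
  | _, .nil, t => t
  | _, .cons c cs, t => absNom c (absNoms cs t)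

end Obj

namespace Formula

open Obj

def top : Formula L := atom (.logic .top)
def bot : Formula L := atom (.logic .bot)
def and (A B : Formula L) : Formula L := app (app (atom (.logic .and)) A) B
def or (A B : Formula L) : Formula L := app (app (atom (.logic .or)) A) B
def imp (A B : Formula L) : Formula L := app (app (atom (.logic .imp)) A) B

/-- `∀x.B` with `P = λx.B`; the instance `B[t/x]` is `app P t`. -/
def all {τ : Ty L.Base} (h : τ.OFree) (P : Obj L (.arr τ .o)) : Formula L :=
  app (atom (.logic (.all τ h))) P

/-- `∃x.B` with `P = λx.B`. -/
def ex {τ : Ty L.Base} (h : τ.OFree) (P : Obj L (.arr τ .o)) : Formula L :=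
  app (atom (.logic (.ex τ h))) P

/-- `∇x.B` with `P = λx.B`. -/
def nabla {τ : Ty L.Base} (h : L.NablaOK τ) (P : Obj L (.arr τ .o)) : Formula L :=
  app (atom (.logic (.nabla τ h))) P

/-- The formula `s ⊵ t`. -/
def nabs {τs : List (Ty L.Base)} {τ : Ty L.Base} (s : Obj L (Ty.arrows τs τ)) (t : Obj L τ) :
    Formula L :=
  app (app (atom (.logic (.nabs τs τ))) s) t

/-- The formula is a nominal abstraction. -/
def IsNabs (B : Formula L) : Prop :=
  ∃ (τs : List (Ty L.Base)) (τ : Ty L.Base) (s : Obj L (Ty.arrows τs τ)) (t : Obj L τ),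
    B = nabs s t

/-- The formula is a nominal abstraction `s ⊵ t` that holds, that is, `s` is
`λc₁ ⋯ λcₙ.t` for some distinct nominal constants. -/
def NabsHolds (B : Formula L) : Prop :=
  ∃ (τs : List (Ty L.Base)) (τ : Ty L.Base) (s : Obj L (Ty.arrows τs τ)) (t : Obj L τ),
    B = nabs s t ∧ ∃ cs : Args L.Nom τs, cs.toList.Nodup ∧ s = absNoms cs t

end Formula

/-! ## Permutations of nominal constants and substitutions -/

/-- Permutations of nominal constants: type preserving bijections that move finitely many. -/
structure NomPerm (L : Lang.{u}) where
  toPerm : ∀ τ, Equiv.Perm (L.Nom τ)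
  finite : {c : Σ τ, L.Nom τ | toPerm c.1 c.2 ≠ c.2}.Finite

/-- The action of a permutation of nominal constants on terms. -/
def NomPerm.act (p : NomPerm L) {τ : Ty L.Base} (t : Obj L τ) : Obj L τ :=
  t.bindAtoms fun σ a =>
    match a with
    | .nom c => .atom (.nom (p.toPerm σ c))
    | a => .atom a

/-- The relation `B ≈ B'`: `B` is `λ`-convertible to `π.B'` for some permutation `π`. -/
def Approx {τ : Ty L.Base} (B B' : Obj L τ) : Prop := ∃ p : NomPerm L, B = p.act B'

/-- Substitutions: type preserving maps from variables to terms (up to `λ`-conversion) that are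
the identity at all but finitely many variables. -/
structure Subst (L : Lang.{u}) : Type u where
  toFun : ∀ τ, EVar L τ → Obj L τ
  finite : {x : Σ τ, EVar L τ | toFun x.1 x.2 ≠ Obj.var x.2}.Finite

namespace Subst

/-- The domain of a substitution. -/
def dom (θ : Subst L) : Set (Σ τ, EVar L τ) := {x | θ.toFun x.1 x.2 ≠ Obj.var x.2}

/-- The support of a substitution. -/
def supp (θ : Subst L) : Set (Σ τ, L.Nom τ) := ⋃ x ∈ θ.dom, (θ.toFun x.1 x.2).supp

/-- The ordinary application `B[θ]`. -/
noncomputable def apply (θ : Subst L) {τ : Ty L.Base} (B : Obj L τ) : Obj L τ :=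
  B.bindAtoms fun σ a =>
    match a with
    | .var x => (θ.toFun σ x).out
    | a => .atom a

/-- `B'` is a result of the nominal capture avoiding application of `θ` to `B`, for some choice
of the permutation that moves the support of `B` off the support of `θ`. -/
def Cas (θ : Subst L) (B B' : Formula L) : Prop :=
  ∃ p : NomPerm L, (∀ c ∈ B.supp, (⟨c.1, p.toPerm c.1 c.2⟩ : Σ τ, L.Nom τ) ∉ θ.supp) ∧
    B' = θ.apply (p.act B)

/-- `θ` is a solution to the nominal abstraction `B`. -/
def IsSolution (θ : Subst L) (B : Formula L) : Prop := ∃ B', θ.Cas B B' ∧ B'.NabsHolds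

/-- The signature `Σθ`. -/
def sig (θ : Subst L) (S : Set (Σ τ, EVar L τ)) : Set (Σ τ, EVar L τ) :=
  (S \ θ.dom) ∪ ⋃ x ∈ θ.dom, (θ.toFun x.1 x.2).fv

end Subst

/-! ## Definitions (the fixed set of clauses) -/

/-- The three forms of clauses: plain, inductive and co-inductive. -/
inductive ClauseKind
  | plain
  | mu
  | nu

/-- A clause `∀x₁ ⋯ xₙ. p x₁ ⋯ xₙ ≜ B p x₁ ⋯ xₙ`. The body `B` is a closed term that contains
neither `p` nor any nominal constant. -/
structure Clause (L : Lang.{u}) where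
  kind : ClauseKind
  args : List (Ty L.Base)
  pred : L.Con (Ty.arrows args .o)
  body : Obj L (.arr (Ty.arrows args .o) (Ty.arrows args .o))
  body_pred : (⟨_, .con pred⟩ : Σ τ, Atom L τ) ∉ body.atoms
  body_fv : body.fv = ∅
  body_supp : body.supp = ∅

/-- A definition: a finite set of clauses with at most one clause for each predicate. No
stratification condition is imposed, so stratified definitions are a special case. -/
structure Definition (L : Lang.{u}) where
  clauses : Set (Clause L)
  finite : clauses.Finite
  unique : ∀ c ∈ clauses, ∀ c' ∈ clauses,
    (⟨c.args, c.pred⟩ : Σ τs : List (Ty L.Base), L.Con (Ty.arrows τs .o)) = ⟨c'.args, c'.pred⟩ →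
      c = c'

/-! ## Sequents, rules and derivations -/

/-- `Σ : Γ ⊢ C`. -/
structure Sequent (L : Lang.{u}) : Type u where
  sig : Set (Σ τ, EVar L τ)
  hyps : Multiset (Formula L)
  concl : Formula L

/-- The signature is finite and contains all the free variables of the formulas. -/
structure Sequent.WF (s : Sequent L) : Prop where
  finite : s.sig.Finite
  hyps : ∀ B ∈ s.hyps, B.fv ⊆ s.sig
  concl : s.concl.fv ⊆ s.sig

/-- Names of the rules. -/
inductive Rule
  | id | cut | cL | botL | orL | orR₁ | orR₂ | topR | andL₁ | andL₂ | andR | impL | impR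
  | allL | allR | nablaL | nablaR | exL | exR | nabsL | nabsR | defL | defR | indL | coindR

/-- The instances of the rules that have finitely many premises (all but `⊵L`): the name of the
rule, the formulas it operates on, the number of premises, the premises and the conclusion. -/
inductive FinRule (D : Definition L) :
    Rule → List (Formula L) → (n : ℕ) → (Fin n → Sequent L) → Sequent L → Prop
  | id {S : Set (Σ τ, EVar L τ)} {Γ : Multiset (Formula L)} {B B' : Formula L} :
      Approx B B' → FinRule D .id [B, B'] 0 ![] ⟨S, B ::ₘ Γ, B'⟩
  | cut {S : Set (Σ τ, EVar L τ)} {Γ Δ : Multiset (Formula L)} {B C : Formula L} :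
      FinRule D .cut [B] 2 ![⟨S, Γ, B⟩, ⟨S, B ::ₘ Δ, C⟩] ⟨S, Γ + Δ, C⟩
  | cL {S : Set (Σ τ, EVar L τ)} {Γ : Multiset (Formula L)} {B C : Formula L} :
      FinRule D .cL [B] 1 ![⟨S, B ::ₘ B ::ₘ Γ, C⟩] ⟨S, B ::ₘ Γ, C⟩
  | botL {S : Set (Σ τ, EVar L τ)} {Γ : Multiset (Formula L)} {C : Formula L} :
      FinRule D .botL [.bot] 0 ![] ⟨S, Formula.bot ::ₘ Γ, C⟩
  | orL {S : Set (Σ τ, EVar L τ)} {Γ : Multiset (Formula L)} {A B C : Formula L} :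
      FinRule D .orL [A.or B] 2 ![⟨S, A ::ₘ Γ, C⟩, ⟨S, B ::ₘ Γ, C⟩] ⟨S, A.or B ::ₘ Γ, C⟩
  | orR₁ {S : Set (Σ τ, EVar L τ)} {Γ : Multiset (Formula L)} {A B : Formula L} :
      FinRule D .orR₁ [A.or B] 1 ![⟨S, Γ, A⟩] ⟨S, Γ, A.or B⟩
  | orR₂ {S : Set (Σ τ, EVar L τ)} {Γ : Multiset (Formula L)} {A B : Formula L} :
      FinRule D .orR₂ [A.or B] 1 ![⟨S, Γ, B⟩] ⟨S, Γ, A.or B⟩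
  | topR {S : Set (Σ τ, EVar L τ)} {Γ : Multiset (Formula L)} :
      FinRule D .topR [.top] 0 ![] ⟨S, Γ, .top⟩
  | andL₁ {S : Set (Σ τ, EVar L τ)} {Γ : Multiset (Formula L)} {A B C : Formula L} :
      FinRule D .andL₁ [A.and B] 1 ![⟨S, A ::ₘ Γ, C⟩] ⟨S, A.and B ::ₘ Γ, C⟩
  | andL₂ {S : Set (Σ τ, EVar L τ)} {Γ : Multiset (Formula L)} {A B C : Formula L} :
      FinRule D .andL₂ [A.and B] 1 ![⟨S, B ::ₘ Γ, C⟩] ⟨S, A.and B ::ₘ Γ, C⟩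
  | andR {S : Set (Σ τ, EVar L τ)} {Γ : Multiset (Formula L)} {A B : Formula L} :
      FinRule D .andR [A.and B] 2 ![⟨S, Γ, A⟩, ⟨S, Γ, B⟩] ⟨S, Γ, A.and B⟩
  | impL {S : Set (Σ τ, EVar L τ)} {Γ : Multiset (Formula L)} {A B C : Formula L} :
      FinRule D .impL [A.imp B] 2 ![⟨S, Γ, A⟩, ⟨S, B ::ₘ Γ, C⟩] ⟨S, A.imp B ::ₘ Γ, C⟩
  | impR {S : Set (Σ τ, EVar L τ)} {Γ : Multiset (Formula L)} {A B : Formula L} :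
      FinRule D .impR [A.imp B] 1 ![⟨S, A ::ₘ Γ, B⟩] ⟨S, Γ, A.imp B⟩
  | allL {S : Set (Σ τ, EVar L τ)} {Γ : Multiset (Formula L)} {C : Formula L} {τ : Ty L.Base}
      {h : τ.OFree} {P : Obj L (.arr τ .o)} (t : Obj L τ) : t.fv ⊆ S →
      FinRule D .allL [.all h P] 1 ![⟨S, P.app t ::ₘ Γ, C⟩] ⟨S, Formula.all h P ::ₘ Γ, C⟩
  | allR {S : Set (Σ τ, EVar L τ)} {Γ : Multiset (Formula L)} {τ : Ty L.Base}
      {h : τ.OFree} {P : Obj L (.arr τ .o)} {τs : List (Ty L.Base)} (cs : Args L.Nom τs)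
      (x : EVar L (Ty.arrows τs τ)) :
      cs.toList.Nodup → {c | c ∈ cs.toList} = P.supp → ⟨_, x⟩ ∉ S →
      FinRule D .allR [.all h P] 1
        ![⟨insert ⟨_, x⟩ S, Γ, P.app ((Obj.var x).apps (cs.map fun _ c => Obj.nom c))⟩]
        ⟨S, Γ, .all h P⟩
  | nablaL {S : Set (Σ τ, EVar L τ)} {Γ : Multiset (Formula L)} {C : Formula L} {τ : Ty L.Base}
      {h : L.NablaOK τ} {P : Obj L (.arr τ .o)} (a : L.Nom τ) : ⟨τ, a⟩ ∉ P.supp →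
      FinRule D .nablaL [.nabla h P] 1 ![⟨S, P.app (Obj.nom a) ::ₘ Γ, C⟩]
        ⟨S, Formula.nabla h P ::ₘ Γ, C⟩
  | nablaR {S : Set (Σ τ, EVar L τ)} {Γ : Multiset (Formula L)} {τ : Ty L.Base}
      {h : L.NablaOK τ} {P : Obj L (.arr τ .o)} (a : L.Nom τ) : ⟨τ, a⟩ ∉ P.supp →
      FinRule D .nablaR [.nabla h P] 1 ![⟨S, Γ, P.app (Obj.nom a)⟩] ⟨S, Γ, .nabla h P⟩
  | exL {S : Set (Σ τ, EVar L τ)} {Γ : Multiset (Formula L)} {C : Formula L} {τ : Ty L.Base}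
      {h : τ.OFree} {P : Obj L (.arr τ .o)} {τs : List (Ty L.Base)} (cs : Args L.Nom τs)
      (x : EVar L (Ty.arrows τs τ)) :
      cs.toList.Nodup → {c | c ∈ cs.toList} = P.supp → ⟨_, x⟩ ∉ S →
      FinRule D .exL [.ex h P] 1
        ![⟨insert ⟨_, x⟩ S, P.app ((Obj.var x).apps (cs.map fun _ c => Obj.nom c)) ::ₘ Γ, C⟩]
        ⟨S, Formula.ex h P ::ₘ Γ, C⟩
  | exR {S : Set (Σ τ, EVar L τ)} {Γ : Multiset (Formula L)} {τ : Ty L.Base}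
      {h : τ.OFree} {P : Obj L (.arr τ .o)} (t : Obj L τ) : t.fv ⊆ S →
      FinRule D .exR [.ex h P] 1 ![⟨S, Γ, P.app t⟩] ⟨S, Γ, .ex h P⟩
  | nabsR {S : Set (Σ τ, EVar L τ)} {Γ : Multiset (Formula L)} {B : Formula L} :
      B.NabsHolds → FinRule D .nabsR [B] 0 ![] ⟨S, Γ, B⟩
  | defL {S : Set (Σ τ, EVar L τ)} {Γ : Multiset (Formula L)} {C : Formula L} (k : Clause L)
      (ts : Args (Obj L) k.args) : k ∈ D.clauses →
      FinRule D .defL [(Obj.con k.pred).apps ts] 1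
        ![⟨S, (k.body.app (Obj.con k.pred)).apps ts ::ₘ Γ, C⟩]
        ⟨S, (Obj.con k.pred).apps ts ::ₘ Γ, C⟩
  | defR {S : Set (Σ τ, EVar L τ)} {Γ : Multiset (Formula L)} (k : Clause L)
      (ts : Args (Obj L) k.args) : k ∈ D.clauses →
      FinRule D .defR [(Obj.con k.pred).apps ts] 1
        ![⟨S, Γ, (k.body.app (Obj.con k.pred)).apps ts⟩]
        ⟨S, Γ, (Obj.con k.pred).apps ts⟩
  | indL {S : Set (Σ τ, EVar L τ)} {Γ : Multiset (Formula L)} {C : Formula L} (k : Clause L)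
      (ts : Args (Obj L) k.args) (I : Obj L (Ty.arrows k.args .o)) (xs : Args (EVar L) k.args) :
      k ∈ D.clauses → k.kind = .mu → I.supp = ∅ → I.fv = ∅ → xs.toList.Nodup →
      FinRule D .indL [(Obj.con k.pred).apps ts] 2
        ![⟨{x | x ∈ xs.toList}, {(k.body.app I).apps (xs.map fun _ x => Obj.var x)},
            I.apps (xs.map fun _ x => Obj.var x)⟩,
          ⟨S, I.apps ts ::ₘ Γ, C⟩]
        ⟨S, (Obj.con k.pred).apps ts ::ₘ Γ, C⟩
  | coindR {S : Set (Σ τ, EVar L τ)} {Γ : Multiset (Formula L)} (k : Clause L)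
      (ts : Args (Obj L) k.args) (I : Obj L (Ty.arrows k.args .o)) (xs : Args (EVar L) k.args) :
      k ∈ D.clauses → k.kind = .nu → I.supp = ∅ → I.fv = ∅ → xs.toList.Nodup →
      FinRule D .coindR [(Obj.con k.pred).apps ts] 2
        ![⟨S, Γ, I.apps ts⟩,
          ⟨{x | x ∈ xs.toList}, {I.apps (xs.map fun _ x => Obj.var x)},
            (k.body.app I).apps (xs.map fun _ x => Obj.var x)⟩]
        ⟨S, Γ, (Obj.con k.pred).apps ts⟩

/-- The instances of `⊵L` for the nominal abstraction `B`: one premise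
`Σθ : Γ⟦θ⟧ ⊢ C⟦θ⟧` for each solution `θ` to `B`, where the permutation used in the nominal
capture avoiding application of `θ` is arbitrary for each formula. -/
def NabsLRule (B : Formula L) (prem : {θ : Subst L // θ.IsSolution B} → Sequent L)
    (c : Sequent L) : Prop :=
  B.IsNabs ∧ ∃ Γ : Multiset (Formula L), c.hyps = B ::ₘ Γ ∧
    ∀ θ, (prem θ).sig = θ.1.sig c.sig ∧ Multiset.Rel θ.1.Cas Γ (prem θ).hyps ∧
      θ.1.Cas c.concl (prem θ).concl

/-- Derivations of a sequent; every node is labelled by a well-formed sequent. -/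
inductive Deriv (D : Definition L) : Sequent L → Type u
  | fin {r : Rule} {ps : List (Formula L)} {n : ℕ} {prem : Fin n → Sequent L} {c : Sequent L}
      (wf : c.WF) (h : FinRule D r ps n prem c) (sub : ∀ i, Deriv D (prem i)) : Deriv D c
  | nabsL {B : Formula L} {prem : {θ : Subst L // θ.IsSolution B} → Sequent L} {c : Sequent L}
      (wf : c.WF) (h : NabsLRule B prem c) (sub : ∀ θ, Deriv D (prem θ)) : Deriv D c

namespace Deriv

variable {D : Definition L}

open Classical in
/-- The height of a derivation: `1` if there are no premise derivations, and the least upper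
bound of the successors of the heights of the premise derivations otherwise. -/
noncomputable def ht {s : Sequent L} : Deriv D s → Ordinal.{u}
  | @fin _ _ _ _ n _ _ _ _ sub => if n = 0 then 1 else ⨆ i, ((sub i).ht + 1)
  | @nabsL _ _ B _ _ _ _ sub =>
      if IsEmpty {θ : Subst L // θ.IsSolution B} then 1 else ⨆ θ, ((sub θ).ht + 1)

/-- The last rule of a derivation. -/
def lastRule {s : Sequent L} : Deriv D s → Rule
  | @fin _ _ r _ _ _ _ _ _ _ => r
  | nabsL _ _ _ => .nabsL

end Deriv

/-! ## Derivations with the same structure -/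

/-- Renamings of eigenvariables. -/
abbrev VarPerm (L : Lang.{u}) : Type u := ∀ τ, Equiv.Perm (EVar L τ)

/-- The action of a renaming of eigenvariables on terms. -/
def VarPerm.act (ρ : VarPerm L) {τ : Ty L.Base} (t : Obj L τ) : Obj L τ :=
  t.bindAtoms fun σ a =>
    match a with
    | .var x => .atom (.var (ρ σ x))
    | a => .atom a

/-- `B'` results from `B` by the renaming `ρ` of eigenvariables and a permutation of nominal
constants. -/
def VarPerm.Renames (ρ : VarPerm L) (B B' : Formula L) : Prop :=
  ∃ p : NomPerm L, B' = p.act (ρ.act B)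

/-- The sequent `s'` results from `s` by the renaming `ρ` of eigenvariables and permutations of
nominal constants in the individual formulas. -/
def VarPerm.RenamesSeq (ρ : VarPerm L) (s s' : Sequent L) : Prop :=
  s'.sig = (fun x : Σ τ, EVar L τ => (⟨x.1, ρ x.1 x.2⟩ : Σ τ, EVar L τ)) '' s.sig ∧
    Multiset.Rel ρ.Renames s.hyps s'.hyps ∧ ρ.Renames s.concl s'.concl

/-- The two derivations are isomorphic as trees, have the same rules at corresponding places, and
the sequents there and the formulas on which these rules operate are obtained from each other via
the renaming `ρ` of eigenvariables and permutations of nominal constants. -/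
inductive Deriv.SameVia {D : Definition L} (ρ : VarPerm L) :
    ∀ {s s' : Sequent L}, Deriv D s → Deriv D s' → Prop
  | fin {r : Rule} {ps ps' : List (Formula L)} {n : ℕ} {prem prem' : Fin n → Sequent L}
      {c c' : Sequent L} {wf : c.WF} {wf' : c'.WF} {h : FinRule D r ps n prem c}
      {h' : FinRule D r ps' n prem' c'} {sub : ∀ i, Deriv D (prem i)}
      {sub' : ∀ i, Deriv D (prem' i)} :
      ρ.RenamesSeq c c' → List.Forall₂ ρ.Renames ps ps' → (∀ i, SameVia ρ (sub i) (sub' i)) →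
      SameVia ρ (Deriv.fin wf h sub) (Deriv.fin wf' h' sub')
  | nabsL {B B' : Formula L} {prem : {θ : Subst L // θ.IsSolution B} → Sequent L}
      {prem' : {θ : Subst L // θ.IsSolution B'} → Sequent L}
      {c c' : Sequent L} {wf : c.WF} {wf' : c'.WF} {h : NabsLRule B prem c}
      {h' : NabsLRule B' prem' c'} {sub : ∀ θ, Deriv D (prem θ)}
      {sub' : ∀ θ, Deriv D (prem' θ)}
      (e : {θ : Subst L // θ.IsSolution B} ≃ {θ : Subst L // θ.IsSolution B'}) :
      ρ.RenamesSeq c c' → ρ.Renames B B' → (∀ θ, SameVia ρ (sub θ) (sub' (e θ))) →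
      SameVia ρ (Deriv.nabsL wf h sub) (Deriv.nabsL wf' h' sub')

/-- Two derivations have the same structure: they are isomorphic as trees, with the same rules at
corresponding places and with formulas that are obtained from each other via a renaming of
eigenvariables and nominal constants. -/
def Deriv.SameStructure {D : Definition L} {s s' : Sequent L} (d : Deriv D s) (d' : Deriv D s') :
    Prop :=
  ∃ ρ : VarPerm L, Deriv.SameVia ρ d d'

end LogicG

/-! Every rule is equivariant: a permutation of nominal constants applied to the formula a rule acts
on gives another instance of the same rule, and the formulas this produces in the premises are the
images of the old ones under that permutation. Formulas not acted on may be permuted independently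
of each other. By induction on the derivation, `Deriv.exists_sameVia` carries the whole tree over.
Eigenvariables are never renamed, so the renaming in the definition of "same structure" is the
identity.

For the rules with finitely many premises this is `FinRule.exists_similar`. It needs the action to
commute with application and with `λc`, to transport supports, and to preserve free variables. The
rules for defined predicates also need permutations to fix clause bodies and invariants, which have
empty support (`NomPerm.act_of_supp_eq_empty`). The support is an intersection over representatives,
so this calls for one representative that omits every moved constant. `Obj.exists_rep_avoiding`
builds it by renaming constants to fresh ones, with no appeal to normal forms.

For `⊵L` nothing has to be permuted in the premises. Nominal capture avoiding application already
allows an arbitrary permutation for each formula, so `≈`-related formulas have the same results and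
the same solutions (`Approx.cas`, `Approx.isSolution`), and the old premises serve again. -/

namespace LogicG

variable {L : Lang.{u}}

/-! ### Atoms of terms under replacement -/

namespace Term

variable {Γ Δ : List (Ty L.Base)} {σ τ : Ty L.Base}

theorem atoms_rename {Γ : List (Ty L.Base)} {τ : Ty L.Base} (t : Term L Γ τ) :
    ∀ {Δ : List (Ty L.Base)} (ρ : ∀ τ, Mem Γ τ → Mem Δ τ), (t.rename ρ).atoms = t.atoms := by
  induction t with
  | bvar m => intros; rfl
  | atom a => intros; rfl
  | app s t ihs iht => intro Δ ρ; simp only [rename, atoms, ihs, iht]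
  | lam t ih => intro Δ ρ; simp only [rename, atoms, ih]

theorem atoms_wk (t : Term L Γ τ) : (wk (σ := σ) t).atoms = t.atoms :=
  atoms_rename t _

theorem mem_atoms_bind {Γ : List (Ty L.Base)} {τ : Ty L.Base} (t : Term L Γ τ)
    {a : Σ τ, Atom L τ} :
    ∀ {Δ : List (Ty L.Base)} {b : ∀ τ, Mem Γ τ → Term L Δ τ} {f : ∀ τ, Atom L τ → Term L Δ τ},
      a ∈ (t.bind b f).atoms →
        (∃ τ m, a ∈ (b τ m).atoms) ∨ ∃ c ∈ t.atoms, a ∈ (f c.1 c.2).atoms := by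
  induction t with
  | bvar m => intro Δ b f h; exact .inl ⟨_, m, h⟩
  | atom c => intro Δ b f h; exact .inr ⟨⟨_, c⟩, rfl, h⟩
  | app s t ihs iht =>
    rintro Δ b f (h | h)
    · exact (ihs h).imp id fun ⟨c, hc, h⟩ => ⟨c, .inl hc, h⟩
    · exact (iht h).imp id fun ⟨c, hc, h⟩ => ⟨c, .inr hc, h⟩
  | lam t ih =>
    intro Δ b f h
    rcases ih h with ⟨τ, m, h⟩ | ⟨c, hc, h⟩
    · cases m with
      | here => exact h.elim
      | there m => exact .inl ⟨_, m, by simpa only [liftSub, atoms_wk] using h⟩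
    · exact .inr ⟨c, hc, by simpa only [atoms_wk] using h⟩

theorem bind_congr {Γ : List (Ty L.Base)} {τ : Ty L.Base} (t : Term L Γ τ) :
    ∀ {Δ : List (Ty L.Base)} (b : ∀ τ, Mem Γ τ → Term L Δ τ) {f f' : ∀ τ, Atom L τ → Term L Δ τ},
      (∀ c ∈ t.atoms, f c.1 c.2 = f' c.1 c.2) → t.bind b f = t.bind b f' := by
  induction t with
  | bvar m => intros; rfl
  | atom a => intro Δ b f f' h; exact h ⟨_, a⟩ rfl
  | app s t ihs iht =>
    intro Δ b f f' h
    simp only [bind, ihs b fun c hc => h c (.inl hc), iht b fun c hc => h c (.inr hc)]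
  | lam t ih =>
    intro Δ b f f' h
    exact congrArg lam (ih _ fun c hc => congrArg wk (h c hc))

theorem replaceNom_self (c : L.Nom τ) : replaceNom c τ (.nom c) = bvar .here := by
  simp [replaceNom]

theorem replaceNom_of_ne (c : L.Nom τ) {a : Atom L σ}
    (h : (⟨σ, a⟩ : Σ σ, Atom L σ) ≠ ⟨τ, .nom c⟩) : replaceNom c σ a = atom a := by
  simp [replaceNom, h]

end Term

/-! ### Atoms and support modulo conversion -/

namespace Obj

variable {σ τ : Ty L.Base}

theorem bindAtoms_bindAtoms (f g : ∀ τ, Atom L τ → Term L [] τ) (t : Obj L τ) :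
    (t.bindAtoms f).bindAtoms g =
      t.bindAtoms fun τ a => (f τ a).bind (fun _ m => .bvar m) g := by
  induction t using Quotient.inductionOn with
  | h t => exact congrArg mk (Term.bind_bind t _ _ _ _)

theorem bindAtoms_atom (t : Obj L τ) : (t.bindAtoms fun _ a => .atom a) = t := by
  induction t using Quotient.inductionOn with
  | h t => exact congrArg mk (Term.bind_id t)

theorem bindAtoms_app (f : ∀ τ, Atom L τ → Term L [] τ) (s : Obj L (.arr σ τ)) (t : Obj L σ) :
    (s.app t).bindAtoms f = (s.bindAtoms f).app (t.bindAtoms f) := by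
  induction s using Quotient.inductionOn with
  | h s =>
    induction t using Quotient.inductionOn with
    | h t => rfl

/-- An atom of a class lies in every representative, in particular in the one obtained by
replacement in `s`. The representative `s` is therefore free to choose. -/
theorem mem_atoms_of_mem_atoms_bindAtoms {f : ∀ τ, Atom L τ → Term L [] τ} {t : Obj L τ}
    {a : Σ τ, Atom L τ} (h : a ∈ (t.bindAtoms f).atoms) (s : Term L [] τ) (hs : mk s = t) :
    ∃ c ∈ s.atoms, a ∈ (f c.1 c.2).atoms := by
  subst hs
  rcases Term.mem_atoms_bind s (h _ rfl) with ⟨_, m, _⟩ | h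
  · cases m
  · exact h

/-- It suffices that `f` fixes the atoms of a single representative, which may be chosen to have few
atoms. -/
theorem bindAtoms_eq_self {f : ∀ τ, Atom L τ → Term L [] τ} (s : Term L [] τ)
    (h : ∀ c ∈ s.atoms, f c.1 c.2 = .atom c.2) : (mk s).bindAtoms f = mk s := by
  refine Eq.trans (congrArg mk ?_) (bindAtoms_atom (mk s))
  exact Term.bind_congr s _ h

/-- A finite set of nominal constants outside the support is avoided by some representative. -/
theorem exists_rep_avoiding (t : Obj L τ) {F : Set (Σ τ, L.Nom τ)} (hF : F.Finite)
    (h : ∀ c ∈ F, c ∉ t.supp) :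
    ∃ s, mk s = t ∧ ∀ c ∈ F, (⟨c.1, .nom c.2⟩ : Σ τ, Atom L τ) ∉ s.atoms := by
  induction F, hF using Set.Finite.induction_on with
  | empty =>
    induction t using Quotient.inductionOn with
    | h t => exact ⟨t, rfl, fun c hc => hc.elim⟩
  | @insert c F hc hF ih =>
    obtain ⟨s, rfl, hs⟩ := ih fun c hc => h c (.inr hc)
    obtain ⟨σ, c⟩ := c
    -- The constant `c` itself shows that its type has nominal constants, hence infinitely many, so
    -- some `d` of that type lies outside `F` and differs from `c`.
    have := L.nom_infinite σ (.inr ⟨c⟩)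
    have hfin : {d : L.Nom σ | (⟨σ, d⟩ : Σ τ, L.Nom τ) ∈ insert ⟨σ, c⟩ F}.Finite :=
      (hF.insert ⟨σ, c⟩).preimage fun x _ y _ hxy => eq_of_heq (Sigma.mk.inj hxy).2
    obtain ⟨d, hd⟩ := hfin.exists_notMem
    let f : ∀ τ, Atom L τ → Term L [] τ := fun τ a => (Term.replaceNom c τ a).inst (.atom (.nom d))
    have hf : ∀ a : Σ τ, Atom L τ, a ≠ ⟨σ, .nom c⟩ → f a.1 a.2 = .atom a.2 := fun a ha => by
      simp only [f, Term.replaceNom_of_ne c ha]; rfl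
    have hfc : f σ (.nom c) = .atom (.nom d) := by
      simp only [f, Term.replaceNom_self]; rfl
    -- Replacing `c` by `d` in `s` stays in the class: the class also has a representative `r`
    -- without `c`, and `f` does nothing to `r`.
    have hmk : (mk s).bindAtoms f = mk s := by
      have := h _ (.inl rfl)
      simp only [supp, atoms, Set.mem_ofPred_eq, not_forall] at this
      obtain ⟨r, hr, hcr⟩ := this
      rw [← hr]
      exact bindAtoms_eq_self r fun a ha => hf a fun e => hcr (e ▸ ha)
    refine ⟨s.bind (fun _ m => .bvar m) f, hmk, fun e he hes => ?_⟩
    rcases Term.mem_atoms_bind s hes with ⟨_, m, _⟩ | ⟨a, has, ha⟩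
    · cases m
    -- An atom of the new representative is either `d`, which is fresh, or an atom of `s` other than
    -- `c`, which avoids `F` by induction.
    by_cases hac : a = ⟨σ, .nom c⟩
    · subst hac
      rw [hfc] at ha
      obtain ⟨e₁, e₂⟩ := e
      cases ha
      exact hd he
    · rw [hf a hac] at ha
      have hae : (⟨e.1, .nom e.2⟩ : Σ τ, Atom L τ) = a := ha
      rcases he with rfl | he
      · exact hac hae.symm
      · exact hs e he (hae ▸ has)

end Obj

/-! ### The action of permutations of nominal constants -/

namespace NomPerm

variable {σ τ : Ty L.Base}

/-- The action on atoms. -/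
def actAtom (p : NomPerm L) : ∀ σ, Atom L σ → Atom L σ
  | σ, .nom c => .nom (p.toPerm σ c)
  | _, .var x => .var x
  | _, .con k => .con k
  | _, .logic l => .logic l

theorem act_eq (p : NomPerm L) (t : Obj L τ) :
    p.act t = t.bindAtoms fun σ a => .atom (p.actAtom σ a) := by
  unfold act
  congr 1
  funext σ a
  cases a <;> rfl

/-- The identity permutation. -/
def one : NomPerm L := ⟨fun _ => 1, by simp⟩

/-- The inverse permutation. -/
def inv (p : NomPerm L) : NomPerm L :=
  ⟨fun τ => (p.toPerm τ)⁻¹, p.finite.subset fun c hc => by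
    simp only [Set.mem_ofPred_eq, ne_eq, Equiv.Perm.inv_eq_iff_eq] at hc ⊢
    exact fun h => hc h.symm⟩

/-- The composition of permutations. -/
def mul (p q : NomPerm L) : NomPerm L :=
  ⟨fun τ => p.toPerm τ * q.toPerm τ, (p.finite.union q.finite).subset fun c hc => by
    by_contra h
    simp only [Set.mem_union, Set.mem_ofPred_eq, not_or, not_not] at h
    exact hc (by rw [Equiv.Perm.mul_apply, h.2, h.1])⟩

theorem act_one (t : Obj L τ) : one.act t = t := by
  rw [act_eq]
  refine Eq.trans ?_ (Obj.bindAtoms_atom t)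
  congr 1
  funext σ a
  cases a <;> rfl

theorem act_mul (p q : NomPerm L) (t : Obj L τ) : (p.mul q).act t = p.act (q.act t) := by
  simp only [act_eq, Obj.bindAtoms_bindAtoms]
  congr 1
  funext σ a
  cases a <;> rfl

theorem act_inv_act (p : NomPerm L) (t : Obj L τ) : p.inv.act (p.act t) = t := by
  rw [← act_mul]
  refine Eq.trans ?_ (act_one t)
  congr 1
  simp [mul, inv, one]

theorem act_app (p : NomPerm L) (s : Obj L (.arr σ τ)) (t : Obj L σ) :
    p.act (s.app t) = (p.act s).app (p.act t) :=
  Obj.bindAtoms_app _ s t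

theorem act_apps (p : NomPerm L) {τs : List (Ty L.Base)} (s : Obj L (Ty.arrows τs τ))
    (ts : Args (Obj L) τs) : p.act (s.apps ts) = (p.act s).apps (ts.map fun _ t => p.act t) := by
  induction ts with
  | nil => rfl
  | cons t ts ih => exact (ih _).trans (congrArg (Obj.apps · _) (p.act_app s t))

theorem act_con (p : NomPerm L) (k : L.Con τ) : p.act (Obj.con k) = Obj.con k := rfl

theorem act_logic (p : NomPerm L) (l : Logical L τ) :
    p.act (Obj.atom (.logic l)) = Obj.atom (.logic l) := rfl

theorem act_nom (p : NomPerm L) (c : L.Nom τ) : p.act (Obj.nom c) = Obj.nom (p.toPerm τ c) := rfl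

theorem actAtom_injective (p : NomPerm L) (τ : Ty L.Base) : Function.Injective (p.actAtom τ) := by
  intro a b h
  cases a <;> cases b <;> simp_all [actAtom]

/-- Permuting any representative of `t` renames its atoms injectively, so the image atom can only
come from `a`. The converse follows by applying this to `p.inv`, which is how free variables and
supports are transported. -/
theorem mem_atoms_of_mem_atoms_act (p : NomPerm L) {t : Obj L τ} {a : Atom L σ}
    (h : (⟨σ, p.actAtom σ a⟩ : Σ τ, Atom L τ) ∈ (p.act t).atoms) : ⟨σ, a⟩ ∈ t.atoms := by
  intro s hs
  rw [act_eq] at h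
  obtain ⟨⟨σ', c⟩, hc, hac⟩ := Obj.mem_atoms_of_mem_atoms_bindAtoms h s hs
  have hac : (⟨σ, p.actAtom σ a⟩ : Σ τ, Atom L τ) = ⟨σ', p.actAtom σ' c⟩ := hac
  obtain ⟨rfl, h⟩ := Sigma.mk.inj hac
  rwa [p.actAtom_injective _ (eq_of_heq h)]

theorem mem_fv_act (p : NomPerm L) {t : Obj L τ} {x : Σ τ, EVar L τ} :
    x ∈ (p.act t).fv ↔ x ∈ t.fv := by
  refine ⟨fun h => p.mem_atoms_of_mem_atoms_act (a := .var x.2) h, fun h => ?_⟩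
  refine p.inv.mem_atoms_of_mem_atoms_act (a := .var x.2) ?_
  rw [act_inv_act]
  exact h

theorem fv_act (p : NomPerm L) (t : Obj L τ) : (p.act t).fv = t.fv :=
  Set.ext fun _ => p.mem_fv_act

theorem mem_supp_act (p : NomPerm L) {t : Obj L τ} {c : L.Nom σ} :
    (⟨σ, p.toPerm σ c⟩ : Σ τ, L.Nom τ) ∈ (p.act t).supp ↔ ⟨σ, c⟩ ∈ t.supp := by
  refine ⟨fun h => p.mem_atoms_of_mem_atoms_act (a := .nom c) h, fun h => ?_⟩
  refine p.inv.mem_atoms_of_mem_atoms_act (a := .nom (p.toPerm σ c)) ?_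
  have : p.inv.actAtom σ (.nom (p.toPerm σ c)) = .nom c :=
    congrArg Atom.nom ((p.toPerm σ).symm_apply_apply c)
  rw [act_inv_act, this]
  exact h

/-- Only finitely many constants are moved, and none is in the support, so one representative avoids
them all and is fixed atom by atom. -/
theorem act_of_supp_eq_empty (p : NomPerm L) {t : Obj L τ} (h : t.supp = ∅) : p.act t = t := by
  obtain ⟨s, rfl, hs⟩ := t.exists_rep_avoiding p.finite fun c _ => by rw [h]; exact id
  rw [act_eq]
  refine Obj.bindAtoms_eq_self s fun ⟨σ, a⟩ ha => ?_
  cases a with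
  | nom c =>
    by_contra hne
    exact hs ⟨σ, c⟩ (fun e => hne (by simp only [actAtom]; rw [e])) ha
  | _ => rfl

/-- By injectivity on atoms, the atoms that become the bound variable are the same whether `c` is
abstracted before permuting or its image is abstracted afterwards. -/
theorem act_absNom (p : NomPerm L) (c : L.Nom σ) (t : Obj L τ) :
    p.act (t.absNom c) = (p.act t).absNom (p.toPerm σ c) := by
  induction t using Quotient.inductionOn with
  | h t =>
    refine (act_eq p _).trans (Eq.trans ?_ (congrArg _ (act_eq p _)).symm)
    refine congrArg Obj.mk (congrArg Term.lam ?_)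
    rw [Term.bind_bind, Term.bind_bind]
    congr 1
    · funext _ m
      cases m
    funext ρ a
    by_cases h : (⟨ρ, a⟩ : Σ τ, Atom L τ) = ⟨σ, .nom c⟩
    · cases h
      rw [Term.replaceNom_self]
      exact (Term.replaceNom_self (p.toPerm σ c)).symm
    · rw [Term.replaceNom_of_ne c h]
      refine (Term.replaceNom_of_ne (p.toPerm σ c) fun h' => h ?_).symm
      obtain ⟨rfl, h'⟩ := Sigma.mk.inj h'
      rw [p.actAtom_injective _ (a₂ := .nom c) (eq_of_heq h')]

theorem act_absNoms (p : NomPerm L) (t : Obj L τ) : ∀ {τs : List (Ty L.Base)} (cs : Args L.Nom τs),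
    p.act (t.absNoms cs) = (p.act t).absNoms (cs.map fun τ c => p.toPerm τ c)
  | _, .nil => rfl
  | _, .cons c cs => (p.act_absNom c _).trans (congrArg _ (act_absNoms p t cs))

end NomPerm

/-! ### Permuted lists of nominal constants -/

namespace Args

variable {Base : Type u} {F G H : Ty Base → Type u}

theorem map_map (g : ∀ τ, F τ → G τ) (h : ∀ τ, G τ → H τ) :
    ∀ {τs : List (Ty Base)} (as : Args F τs),
      (as.map g).map h = as.map fun τ a => h τ (g τ a)
  | _, nil => rfl
  | _, cons a as => congrArg (cons _) (map_map g h as)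

theorem toList_map (g : ∀ τ, F τ → G τ) : ∀ {τs : List (Ty Base)} (as : Args F τs),
    (as.map g).toList = as.toList.map fun a => ⟨a.1, g a.1 a.2⟩
  | _, nil => rfl
  | _, cons _ as => congrArg (_ :: ·) (toList_map g as)

end Args

namespace NomPerm

variable {σ τ : Ty L.Base}

theorem sigma_injective (p : NomPerm L) :
    Function.Injective fun c : Σ τ, L.Nom τ => (⟨c.1, p.toPerm c.1 c.2⟩ : Σ τ, L.Nom τ) := by
  rintro ⟨σ, c⟩ ⟨τ, d⟩ h
  obtain ⟨rfl, h⟩ := Sigma.mk.inj h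
  exact congrArg _ ((p.toPerm σ).injective (eq_of_heq h))

theorem nodup_map (p : NomPerm L) {τs : List (Ty L.Base)} {cs : Args L.Nom τs}
    (h : cs.toList.Nodup) : (cs.map fun τ c => p.toPerm τ c).toList.Nodup := by
  rw [Args.toList_map]
  exact h.map p.sigma_injective

/-- Transports the side condition of `∀R` and `∃L` on the list of constants to which the
eigenvariable is applied. -/
theorem setOf_mem_map_eq_supp_act (p : NomPerm L) {τs : List (Ty L.Base)} {cs : Args L.Nom τs}
    {t : Obj L τ} (h : {c | c ∈ cs.toList} = t.supp) :
    {c | c ∈ (cs.map fun τ c => p.toPerm τ c).toList} = (p.act t).supp := by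
  ext ⟨σ, c⟩
  obtain ⟨c, rfl⟩ := (p.toPerm σ).surjective c
  rw [p.mem_supp_act, ← h, Args.toList_map]
  exact List.mem_map_of_injective p.sigma_injective (a := ⟨σ, c⟩)

/-- The raised eigenvariable is untouched by `p`, so the permuted instance of `∀R` or `∃L` can keep
it, with its type, and permute only its arguments. -/
theorem act_apps_nom (p : NomPerm L) {τs : List (Ty L.Base)} (x : EVar L (Ty.arrows τs τ))
    (cs : Args L.Nom τs) :
    p.act ((Obj.var x).apps (cs.map fun _ c => Obj.nom c)) =
      (Obj.var x).apps ((cs.map fun τ c => p.toPerm τ c).map fun _ c => Obj.nom c) := by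
  rw [act_apps, Args.map_map, Args.map_map]
  rfl

end NomPerm

/-! ### Equivariance of the logical constants and of nominal abstraction -/

namespace Formula

variable {τ : Ty L.Base} (p : NomPerm L)

theorem act_and (A B : Formula L) : p.act (A.and B) = and (p.act A) (p.act B) := by
  simp only [and, p.act_app, p.act_logic]

theorem act_or (A B : Formula L) : p.act (A.or B) = or (p.act A) (p.act B) := by
  simp only [or, p.act_app, p.act_logic]

theorem act_imp (A B : Formula L) : p.act (A.imp B) = imp (p.act A) (p.act B) := by
  simp only [imp, p.act_app, p.act_logic]

theorem act_all (h : τ.OFree) (P : Obj L (.arr τ .o)) : p.act (all h P) = all h (p.act P) := by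
  simp only [all, p.act_app, p.act_logic]

theorem act_ex (h : τ.OFree) (P : Obj L (.arr τ .o)) : p.act (ex h P) = ex h (p.act P) := by
  simp only [ex, p.act_app, p.act_logic]

theorem act_nabla (h : L.NablaOK τ) (P : Obj L (.arr τ .o)) :
    p.act (nabla h P) = nabla h (p.act P) := by
  simp only [nabla, p.act_app, p.act_logic]

theorem act_nabs {τs : List (Ty L.Base)} (s : Obj L (Ty.arrows τs τ)) (t : Obj L τ) :
    p.act (nabs s t) = nabs (p.act s) (p.act t) := by
  simp only [nabs, p.act_app, p.act_logic]

theorem IsNabs.act {B : Formula L} (h : B.IsNabs) : IsNabs (p.act B) := by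
  obtain ⟨τs, τ, s, t, rfl⟩ := h
  exact ⟨τs, τ, p.act s, p.act t, act_nabs p s t⟩

theorem NabsHolds.act {B : Formula L} (h : B.NabsHolds) : NabsHolds (p.act B) := by
  obtain ⟨τs, τ, s, t, rfl, cs, hcs, rfl⟩ := h
  exact ⟨τs, τ, _, p.act t, act_nabs p _ t, _, p.nodup_map hcs, p.act_absNoms t cs⟩

end Formula

/-! ### The relation `≈` on formulas and similarity of sequents -/

namespace Approx

variable {τ : Ty L.Base}

theorem refl (B : Obj L τ) : Approx B B := ⟨.one, (NomPerm.act_one B).symm⟩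

theorem act (p : NomPerm L) (B : Obj L τ) : Approx B (p.act B) :=
  ⟨p.inv, (p.act_inv_act B).symm⟩

theorem exists_eq_act {B B' : Obj L τ} (h : Approx B B') : ∃ p : NomPerm L, B' = p.act B := by
  obtain ⟨p, rfl⟩ := h
  exact ⟨p.inv, (p.act_inv_act B').symm⟩

theorem symm {B B' : Obj L τ} (h : Approx B B') : Approx B' B := h.exists_eq_act

theorem trans {A B C : Obj L τ} (h : Approx A B) (h' : Approx B C) : Approx A C := by
  obtain ⟨p, rfl⟩ := h
  obtain ⟨q, rfl⟩ := h'
  exact ⟨p.mul q, (p.act_mul q C).symm⟩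

theorem fv_eq {B B' : Obj L τ} (h : Approx B B') : B.fv = B'.fv := by
  obtain ⟨p, rfl⟩ := h
  exact p.fv_act B'

/-- The permutation relating `B` to `B'` is absorbed into the one that moves the support off that of
`θ`, so exactly the same result `A` is reached. -/
theorem cas {θ : Subst L} {A B B' : Formula L} (h : Approx B B') (hA : θ.Cas B A) :
    θ.Cas B' A := by
  obtain ⟨p, rfl⟩ := h
  obtain ⟨q, hq, rfl⟩ := hA
  refine ⟨q.mul p, fun c hc => hq ⟨c.1, p.toPerm c.1 c.2⟩ (p.mem_supp_act.2 hc), ?_⟩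
  rw [q.act_mul]

theorem isSolution {θ : Subst L} {B B' : Formula L} (h : Approx B B') (hθ : θ.IsSolution B) :
    θ.IsSolution B' := by
  obtain ⟨A, hA, hA'⟩ := hθ
  exact ⟨A, h.cas hA, hA'⟩

theorem renames {B B' : Formula L} (h : Approx B B') : VarPerm.Renames 1 B B' := by
  obtain ⟨p, rfl⟩ := h.exists_eq_act
  refine ⟨p, congrArg p.act (Eq.trans (Obj.bindAtoms_atom B).symm ?_)⟩
  unfold VarPerm.act
  congr 1
  funext σ a
  cases a <;> rfl

end Approx

theorem rel_cas {θ : Subst L} {Γ Γ' Δ : Multiset (Formula L)} (h : Multiset.Rel Approx Γ Γ')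
    (hΔ : Multiset.Rel θ.Cas Γ Δ) : Multiset.Rel θ.Cas Γ' Δ := by
  induction h generalizing Δ with
  | zero => exact hΔ
  | cons hB _ ih =>
    obtain ⟨A, Δ', hA, hΔ', rfl⟩ := Multiset.rel_cons_left.1 hΔ
    exact .cons (hB.cas hA) (ih hΔ')

/-- Sequents over the same signature that agree up to permutations of the nominal constants in the
individual formulas. -/
structure Sequent.Similar (s s' : Sequent L) : Prop where
  sig : s'.sig = s.sig
  hyps : Multiset.Rel Approx s.hyps s'.hyps
  concl : Approx s.concl s'.concl

theorem multisetRel_approx_refl (Γ : Multiset (Formula L)) : Multiset.Rel Approx Γ Γ :=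
  Multiset.rel_refl_of_refl_on fun B _ => .refl B

namespace Sequent.Similar

variable {s s' : Sequent L}

theorem refl (s : Sequent L) : s.Similar s := ⟨rfl, multisetRel_approx_refl _, .refl _⟩

theorem wf (h : s.Similar s') (hs : s.WF) : s'.WF where
  finite := h.sig ▸ hs.finite
  hyps B' hB' := by
    obtain ⟨B, hB, hBB'⟩ := Multiset.exists_mem_of_rel_of_mem
      (Multiset.rel_flip.2 h.hyps) hB'
    rw [← Approx.fv_eq hBB', h.sig]
    exact hs.hyps B hB
  concl := by
    rw [← h.concl.fv_eq, h.sig]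
    exact hs.concl

theorem renamesSeq (h : s.Similar s') : VarPerm.RenamesSeq 1 s s' :=
  ⟨by rw [h.sig]; exact (Set.image_id s.sig).symm,
    h.hyps.mono fun _ _ _ _ h => h.renames, h.concl.renames⟩

end Sequent.Similar

/-! ### Transport of single rule instances -/

open Formula in
-- Except in `id`, `cut` and `cL`, a permutation `p` taking the principal formula to its counterpart
-- is applied to the data of the instance, while side formulas keep their own permutations. Each new
-- premise formula is then `p.act` of the old one.
theorem FinRule.exists_similar {D : Definition L} {r : Rule} {ps : List (Formula L)} {n : ℕ}
    {prem : Fin n → Sequent L} {c c' : Sequent L} (h : FinRule D r ps n prem c)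
    (hc : c.Similar c') :
    ∃ (ps' : List (Formula L)) (prem' : Fin n → Sequent L), FinRule D r ps' n prem' c' ∧
      List.Forall₂ Approx ps ps' ∧ ∀ i, (prem i).Similar (prem' i) := by
  obtain ⟨S, Γ, C⟩ := c
  obtain ⟨S', Γ', C'⟩ := c'
  obtain ⟨hS, hΓ, hC⟩ := hc
  dsimp only at hS hΓ hC
  subst hS
  -- Packaging by number of premises. Without premises the list of principal formulas is left
  -- general, because `id` operates on two formulas.
  have zero {ps ps' : List (Formula L)} {c' : Sequent L} {r : Rule}
      (h : FinRule D r ps' 0 ![] c') (hps : List.Forall₂ Approx ps ps') :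
      ∃ (ps' : List (Formula L)) (prem' : Fin 0 → Sequent L), FinRule D r ps' 0 prem' c' ∧
        List.Forall₂ Approx ps ps' ∧ ∀ i, ((![] : Fin 0 → Sequent L) i).Similar (prem' i) :=
    ⟨ps', _, h, hps, fun i => i.elim0⟩
  have one {p p' : Formula L} {c' s s' : Sequent L} {r : Rule}
      (h : FinRule D r [p'] 1 ![s'] c') (hp : Approx p p') (hs : s.Similar s') :
      ∃ (ps' : List (Formula L)) (prem' : Fin 1 → Sequent L), FinRule D r ps' 1 prem' c' ∧
        List.Forall₂ Approx [p] ps' ∧ ∀ i, (![s] i).Similar (prem' i) :=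
    ⟨_, _, h, .cons hp .nil, fun i => by fin_cases i; exact hs⟩
  have two {p p' : Formula L} {c' s s' t t' : Sequent L} {r : Rule}
      (h : FinRule D r [p'] 2 ![s', t'] c') (hp : Approx p p') (hs : s.Similar s')
      (ht : t.Similar t') :
      ∃ (ps' : List (Formula L)) (prem' : Fin 2 → Sequent L), FinRule D r ps' 2 prem' c' ∧
        List.Forall₂ Approx [p] ps' ∧ ∀ i, (![s, t] i).Similar (prem' i) :=
    ⟨_, _, h, .cons hp .nil, fun i => by fin_cases i; exacts [hs, ht]⟩
  cases h with
  | @id S Γ B B' hB =>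
    obtain ⟨A, Γ', hA, hΓ', rfl⟩ := Multiset.rel_cons_left.1 hΓ
    exact zero (.id (hA.symm.trans (hB.trans hC))) (.cons hA (.cons hC .nil))
  | @cut S Γ Δ B C =>
    obtain ⟨Γ', Δ', hΓ', hΔ', rfl⟩ := Multiset.rel_add_left.1 hΓ
    -- The cut formula is absent from the conclusion, so it is kept as it is.
    exact two .cut (.refl B) ⟨rfl, hΓ', .refl B⟩ ⟨rfl, .cons (.refl B) hΔ', hC⟩
  | cL =>
    obtain ⟨A, Γ', hA, hΓ', rfl⟩ := Multiset.rel_cons_left.1 hΓ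
    exact one .cL hA ⟨rfl, .cons hA (.cons hA hΓ'), hC⟩
  | botL =>
    obtain ⟨A, Γ', hA, hΓ', rfl⟩ := Multiset.rel_cons_left.1 hΓ
    obtain ⟨p, rfl⟩ := hA.exists_eq_act
    exact zero .botL (.cons hA .nil)
  | @orL S Γ A B C =>
    obtain ⟨E, Γ', hE, hΓ', rfl⟩ := Multiset.rel_cons_left.1 hΓ
    obtain ⟨p, rfl⟩ := hE.exists_eq_act
    rw [act_or] at hE ⊢
    exact two .orL hE ⟨rfl, .cons (.act p A) hΓ', hC⟩ ⟨rfl, .cons (.act p B) hΓ', hC⟩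
  | @orR₁ S Γ A B =>
    obtain ⟨p, rfl⟩ := hC.exists_eq_act
    rw [act_or] at hC ⊢
    exact one .orR₁ hC ⟨rfl, hΓ, .act p A⟩
  | @orR₂ S Γ A B =>
    obtain ⟨p, rfl⟩ := hC.exists_eq_act
    rw [act_or] at hC ⊢
    exact one .orR₂ hC ⟨rfl, hΓ, .act p B⟩
  | topR =>
    obtain ⟨p, rfl⟩ := hC.exists_eq_act
    exact zero .topR (.cons hC .nil)
  | @andL₁ S Γ A B C =>
    obtain ⟨E, Γ', hE, hΓ', rfl⟩ := Multiset.rel_cons_left.1 hΓ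
    obtain ⟨p, rfl⟩ := hE.exists_eq_act
    rw [act_and] at hE ⊢
    exact one .andL₁ hE ⟨rfl, .cons (.act p A) hΓ', hC⟩
  | @andL₂ S Γ A B C =>
    obtain ⟨E, Γ', hE, hΓ', rfl⟩ := Multiset.rel_cons_left.1 hΓ
    obtain ⟨p, rfl⟩ := hE.exists_eq_act
    rw [act_and] at hE ⊢
    exact one .andL₂ hE ⟨rfl, .cons (.act p B) hΓ', hC⟩
  | @andR S Γ A B =>
    obtain ⟨p, rfl⟩ := hC.exists_eq_act
    rw [act_and] at hC ⊢
    exact two .andR hC ⟨rfl, hΓ, .act p A⟩ ⟨rfl, hΓ, .act p B⟩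
  | @impL S Γ A B C =>
    obtain ⟨E, Γ', hE, hΓ', rfl⟩ := Multiset.rel_cons_left.1 hΓ
    obtain ⟨p, rfl⟩ := hE.exists_eq_act
    rw [act_imp] at hE ⊢
    exact two .impL hE ⟨rfl, hΓ', .act p A⟩ ⟨rfl, .cons (.act p B) hΓ', hC⟩
  | @impR S Γ A B =>
    obtain ⟨p, rfl⟩ := hC.exists_eq_act
    rw [act_imp] at hC ⊢
    exact one .impR hC ⟨rfl, .cons (.act p A) hΓ, .act p B⟩
  | @allL S Γ C τ hτ P t ht =>
    obtain ⟨E, Γ', hE, hΓ', rfl⟩ := Multiset.rel_cons_left.1 hΓ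
    obtain ⟨p, rfl⟩ := hE.exists_eq_act
    rw [act_all] at hE ⊢
    -- The instantiating term is permuted along with `P`; its free variables stay in the signature.
    refine one (.allL (p.act t) (by rwa [p.fv_act])) hE ⟨rfl, .cons ?_ hΓ', hC⟩
    rw [← p.act_app]
    exact .act p _
  | @allR S Γ τ hτ P τs cs x hcs hP hx =>
    obtain ⟨p, rfl⟩ := hC.exists_eq_act
    rw [act_all] at hC ⊢
    refine one (.allR _ x (p.nodup_map hcs) (p.setOf_mem_map_eq_supp_act hP) hx) hC
      ⟨rfl, hΓ, ?_⟩
    rw [← p.act_apps_nom, ← p.act_app]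
    exact .act p _
  | @nablaL S Γ C τ hτ P a ha =>
    obtain ⟨E, Γ', hE, hΓ', rfl⟩ := Multiset.rel_cons_left.1 hΓ
    obtain ⟨p, rfl⟩ := hE.exists_eq_act
    rw [act_nabla] at hE ⊢
    refine one (.nablaL (p.toPerm τ a) fun h => ha (p.mem_supp_act.1 h)) hE
      ⟨rfl, .cons ?_ hΓ', hC⟩
    rw [← p.act_nom, ← p.act_app]
    exact .act p _
  | @nablaR S Γ τ hτ P a ha =>
    obtain ⟨p, rfl⟩ := hC.exists_eq_act
    rw [act_nabla] at hC ⊢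
    refine one (.nablaR (p.toPerm τ a) fun h => ha (p.mem_supp_act.1 h)) hC ⟨rfl, hΓ, ?_⟩
    rw [← p.act_nom, ← p.act_app]
    exact .act p _
  | @exL S Γ C τ hτ P τs cs x hcs hP hx =>
    obtain ⟨E, Γ', hE, hΓ', rfl⟩ := Multiset.rel_cons_left.1 hΓ
    obtain ⟨p, rfl⟩ := hE.exists_eq_act
    rw [act_ex] at hE ⊢
    refine one (.exL _ x (p.nodup_map hcs) (p.setOf_mem_map_eq_supp_act hP) hx) hE
      ⟨rfl, .cons ?_ hΓ', hC⟩
    rw [← p.act_apps_nom, ← p.act_app]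
    exact .act p _
  | @exR S Γ τ hτ P t ht =>
    obtain ⟨p, rfl⟩ := hC.exists_eq_act
    rw [act_ex] at hC ⊢
    refine one (.exR (p.act t) (by rwa [p.fv_act])) hC ⟨rfl, hΓ, ?_⟩
    rw [← p.act_app]
    exact .act p _
  | nabsR hB =>
    obtain ⟨p, rfl⟩ := hC.exists_eq_act
    exact zero (.nabsR (hB.act p)) (.cons hC .nil)
  | @defL S Γ C k ts hk =>
    obtain ⟨E, Γ', hE, hΓ', rfl⟩ := Multiset.rel_cons_left.1 hΓ
    obtain ⟨p, rfl⟩ := hE.exists_eq_act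
    rw [p.act_apps, p.act_con] at hE ⊢
    refine one (.defL k _ hk) hE ⟨rfl, .cons ?_ hΓ', hC⟩
    -- The clause body has empty support and the predicate is non-nominal, so `p` reaches only the
    -- arguments: the permuted unfolding is the unfolding of the permuted atom.
    have h := Approx.act p ((k.body.app (Obj.con k.pred)).apps ts)
    rwa [p.act_apps, p.act_app, p.act_con, p.act_of_supp_eq_empty k.body_supp] at h
  | @defR S Γ k ts hk =>
    obtain ⟨p, rfl⟩ := hC.exists_eq_act
    rw [p.act_apps, p.act_con] at hC ⊢
    refine one (.defR k _ hk) hC ⟨rfl, hΓ, ?_⟩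
    have h := Approx.act p ((k.body.app (Obj.con k.pred)).apps ts)
    rwa [p.act_apps, p.act_app, p.act_con, p.act_of_supp_eq_empty k.body_supp] at h
  | @indL S Γ C k ts I xs hk hkind hI hI' hxs =>
    obtain ⟨E, Γ', hE, hΓ', rfl⟩ := Multiset.rel_cons_left.1 hΓ
    obtain ⟨p, rfl⟩ := hE.exists_eq_act
    rw [p.act_apps, p.act_con] at hE ⊢
    -- The same invariant works: the premise on its closure does not mention `ts` and is unchanged,
    -- and `p` fixes `I` in the other premise.
    refine two (.indL k _ I xs hk hkind hI hI' hxs) hE (.refl _) ⟨rfl, .cons ?_ hΓ', hC⟩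
    have h := Approx.act p (I.apps ts)
    rwa [p.act_apps, p.act_of_supp_eq_empty hI] at h
  | @coindR S Γ k ts I xs hk hkind hI hI' hxs =>
    obtain ⟨p, rfl⟩ := hC.exists_eq_act
    rw [p.act_apps, p.act_con] at hC ⊢
    refine two (.coindR k _ I xs hk hkind hI hI' hxs) hC ⟨rfl, hΓ, ?_⟩ (.refl _)
    have h := Approx.act p (I.apps ts)
    rwa [p.act_apps, p.act_of_supp_eq_empty hI] at h

/-! ### Transport of derivations, heights and last rules -/

namespace Deriv

variable {D : Definition L}

theorem exists_sameVia {s : Sequent L} (d : Deriv D s) :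
    ∀ {s' : Sequent L}, s.Similar s' → ∃ d' : Deriv D s', SameVia 1 d d' := by
  induction d with
  | fin wf h sub ih =>
    intro s' hs
    obtain ⟨ps', prem', h', hps, hprem⟩ := h.exists_similar hs
    choose sub' hsub' using fun i => ih i (hprem i)
    exact ⟨.fin (hs.wf wf) h' sub',
      .fin hs.renamesSeq (hps.imp fun _ _ h => h.renames) hsub'⟩
  | @nabsL B prem c wf h sub ih =>
    intro s' hs
    obtain ⟨hB, Γ, hΓ, hprem⟩ := id h
    have hyps := hs.hyps
    rw [hΓ] at hyps
    obtain ⟨B', Γ', hBB', hΓΓ', hΓ'⟩ := Multiset.rel_cons_left.1 hyps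
    -- The two nominal abstractions have literally the same solutions, so `e` is the identity on
    -- substitutions.
    let e : {θ : Subst L // θ.IsSolution B} ≃ {θ : Subst L // θ.IsSolution B'} :=
      Equiv.subtypeEquivRight fun θ => ⟨hBB'.isSolution, hBB'.symm.isSolution⟩
    -- The old premises are reused without change: each is also a result of applying `θ` to the new
    -- conclusion.
    have h' : NabsLRule B' (fun θ => prem (e.symm θ)) s' := by
      refine ⟨?_, Γ', hΓ', fun θ => ?_⟩
      · obtain ⟨p, rfl⟩ := hBB'.exists_eq_act
        exact hB.act p
      · obtain ⟨hsig, hrel, hconcl⟩ := hprem (e.symm θ)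
        exact ⟨by rw [hs.sig]; exact hsig, rel_cas hΓΓ' hrel, hs.concl.cas hconcl⟩
    -- Although the premise sequents do not change, the induction hypothesis at a reflexive
    -- similarity supplies the required `SameVia 1` for the subderivations.
    choose sub' hsub' using fun θ => ih θ (.refl (prem θ))
    exact ⟨.nabsL (hs.wf wf) h' fun θ => sub' (e.symm θ),
      .nabsL e hs.renamesSeq hBB'.renames fun θ => hsub' θ⟩

theorem SameVia.ht_eq {ρ : VarPerm L} {s s' : Sequent L} {d : Deriv D s} {d' : Deriv D s'}
    (h : SameVia ρ d d') : d.ht = d'.ht := by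
  induction h with
  | fin _ _ _ ih => simp only [ht, ih]
  | @nabsL _ _ _ _ _ _ _ _ _ _ _ sub' e _ _ _ ih =>
    simp only [ht, ih]
    -- The premises are indexed by different types of solutions; the supremum is reindexed along
    -- `e`, which also matches the case of no solutions.
    rw [← e.iSup_comp (g := fun θ => (sub' θ).ht + 1)]
    classical
    exact if_congr e.isEmpty_congr rfl rfl

theorem SameVia.lastRule_eq {ρ : VarPerm L} {s s' : Sequent L} {d : Deriv D s} {d' : Deriv D s'}
    (h : SameVia ρ d d') : d.lastRule = d'.lastRule := by
  cases h <;> rfl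

end Deriv

end LogicG

theorem mainTheorem4 (L : LogicG.Lang.{u}) (D : LogicG.Definition L)
    (S : Set (Σ τ, LogicG.EVar L τ)) (n : ℕ) (B B' : Fin (n + 1) → LogicG.Formula L)
    (hB : ∀ i, LogicG.Approx (B i) (B' i))
    (d : LogicG.Deriv D ⟨S, Multiset.ofList (List.ofFn fun i : Fin n => B i.succ), B 0⟩) :
    ∃ d' : LogicG.Deriv D
        ⟨S, Multiset.ofList (List.ofFn fun i : Fin n => B' i.succ), B' 0⟩,
      d.SameStructure d' ∧ d.ht = d'.ht ∧ d.lastRule = d'.lastRule := by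
  have hrel : Multiset.Rel LogicG.Approx
      (Multiset.ofList (List.ofFn fun i : Fin n => B i.succ))
      (Multiset.ofList (List.ofFn fun i : Fin n => B' i.succ)) := by
    -- Both hypothesis multisets are images of the same list of indices, so it suffices to pair each
    -- index with itself.
    rw [List.ofFn_eq_map, List.ofFn_eq_map, ← Multiset.map_coe, ← Multiset.map_coe,
      Multiset.rel_map]
    exact Multiset.rel_refl_of_refl_on fun i _ => hB i.succ
  obtain ⟨d', h⟩ := d.exists_sameVia (s' := ⟨S, _, B' 0⟩) ⟨rfl, hrel, hB 0⟩
  exact ⟨d', ⟨1, h⟩, h.ht_eq, h.lastRule_eq⟩
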